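/- Let $0\le\alpha<1$ and let $\mathbb D$ be the open unit disk. Let $\mathcal P^0_{\mathcal H}(\alpha)$ be the class of all harmonic mappings $f=h+\overline g$ on $\mathbb D$, where $h,g$ are analytic in $\mathbb D$ with $h(0)=g(0)=0$, $h'(0)=1$, $g'(0)=0$, and $$\operatorname{Re}\,(h'(z)-\alpha)>|g'(z)|\qquad(z\in\mathbb D).$$ Write $h(z)=z+\sum_{n\ge2}a_nz^n$ and $g(z)=\sum_{n\ge2}b_nz^n$. For $0\le r<1$ let $S_r$ be the area of $f(\{|z|<r\})$, let $d(f(0),\partial f(\mathbb D))$ be the Euclidean distance from $f(0)$ to the boundary of $f(\mathbb D)$, and for an integer $N\ge1$ let $P(w)=w^N+w^{N-1}+\cdots+w$. Then the equation $$r-1-2(1-\alpha)\bigl(r-1+\ln(2-2r)\bigr)+P\Bigl(r^2-4(1-\alpha)^2\bigl(r^2+\ln(1-r^2)\bigr)\Bigr)=0$$ has a smallest root $r_N(\alpha)$ in $(0,1)$, and for every $f\in\mathcal P^0_{\mathcal H}(\alpha)$ the boundary $\partial f(\mathbb D)$ is non-empty and, for every $0\le r\le r_N(\alpha)$, the following series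 converges, $S_r$ is finite, and $$r+\sum_{n=2}^\infty(|a_n|+|b_n|)r^n+P\Bigl(\frac{S_r}{\pi}\Bigr)\le d\bigl(f(0),\partial f(\mathbb D)\bigr).$$ The constant $r_N(\alpha)$ is best possible: for every $r$ with $r_N(\alpha)<r<1$ there is an $f\in\mathcal P^0_{\mathcal H}(\alpha)$ for which this inequality fails. -/

import Mathlib

noncomputable section

namespace HarmonicBohr

/-- The complex-valued harmonic mapping `f = h + conj g` with analytic part `h` and
co-analytic part `g`. -/
def harmonicMap (h g : ℂ → ℂ) (z : ℂ) : ℂ :=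
  h z + (starRingEnd ℂ) (g z)

/-- `f = h + conj g` belongs to the class `P_H^0(α)`: `h`, `g` are analytic in the unit disk,
`h(0) = 0`, `h'(0) = 1`, `g(0) = 0`, `g'(0) = 0`, and `Re (h'(z) - α) > |g'(z)|` for all `z` in the
disk. Only the values of `h` and `g` on the open unit disk matter. -/
structure MemPH0 (α : ℝ) (h g : ℂ → ℂ) : Prop where
  analytic_h : DifferentiableOn ℂ h (Metric.ball 0 1)
  analytic_g : DifferentiableOn ℂ g (Metric.ball 0 1)
  h_zero : h 0 = 0
  deriv_h_zero : deriv h 0 = 1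
  g_zero : g 0 = 0
  deriv_g_zero : deriv g 0 = 0
  re_gt : ∀ z ∈ Metric.ball (0 : ℂ) 1, ‖deriv g z‖ < (deriv h z - (α : ℂ)).re

/-- The `n`-th Taylor coefficient of `h` at the origin. -/
def taylorCoeff (h : ℂ → ℂ) (n : ℕ) : ℂ :=
  iteratedDeriv n h 0 / (n.factorial : ℂ)

/-- The term `(|a_n| + |b_n|) r^n`, where `a_n`, `b_n` are the Taylor coefficients of `h`, `g`. -/
def bohrTerm (h g : ℂ → ℂ) (r : ℝ) (n : ℕ) : ℝ :=
  (‖taylorCoeff h n‖ + ‖taylorCoeff g n‖) * r ^ n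

/-- The image of the disk `|z| < r` under `f = h + conj g`. -/
def imageDisk (h g : ℂ → ℂ) (r : ℝ) : Set ℂ :=
  harmonicMap h g '' Metric.ball 0 r

/-- The area `S_r` of the image of the disk `|z| < r`. -/
def area (h g : ℂ → ℂ) (r : ℝ) : ℝ :=
  (MeasureTheory.volume (imageDisk h g r)).toReal

/-- `P(w) = w^N + w^(N-1) + ⋯ + w`. -/
def P (N : ℕ) (w : ℝ) : ℝ :=
  ∑ k ∈ Finset.Icc 1 N, w ^ k

/-- `r + ∑_{n ≥ 2} (|a_n| + |b_n|) r^n + P(S_r / π)`. -/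
def bohrSum (N : ℕ) (h g : ℂ → ℂ) (r : ℝ) : ℝ :=
  r + ∑' n : ℕ, bohrTerm h g r (n + 2) + P N (area h g r / Real.pi)

/-- The Euclidean distance from `f(0)` to the boundary of the image of the unit disk. -/
def distBoundary (h g : ℂ → ℂ) : ℝ :=
  Metric.infDist (harmonicMap h g 0) (frontier (imageDisk h g 1))

/-- The left-hand side of the equation that defines the radius. -/
def radiusFun (N : ℕ) (α r : ℝ) : ℝ :=
  r - 1 - 2 * (1 - α) * (r - 1 + Real.log (2 - 2 * r))
    + P N (r ^ 2 - 4 * (1 - α) ^ 2 * (r ^ 2 + Real.log (1 - r ^ 2)))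

end HarmonicBohr

end

/-!
The extremal mapping is the analytic function `z + ∑_{n ≥ 2} (2 (1 - α) / n) z^n`; every quantity in
the inequality is bounded by its value for that function.

For `f = h + conj g` in the class and `|ε| = 1`, the function `h' + ε g'` equals `1` at the origin
and has real part at least `α`. Two classical facts about such functions are used. Carathéodory's
inequality (`norm_coeff_le_of_re_ge`), with `ε` chosen to align the coefficients, gives
`n (|a_n| + |b_n|) ≤ 2 (1 - α)`. Harnack's inequality (`re_ge_of_re_ge`), integrated along a radius
with `ε` the square of its direction, gives `|f(z)| ≥ growth α |z|`
(`MemPH0.growth_le_norm`). As `f` is an open map, boundary points of `f(𝔻)` are limits of values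
`f(z)` with `|z| → 1`, so the distance to the boundary is at least
`growth α 1 = 1 - 2 (1 - α) (1 - log 2)`.

The boundary is non-empty: `f` is injective because `Re h' > |g'|` on the convex disk, so if it were
onto the plane then `|f|` would be arbitrarily large on suitable circles, whereas by Parseval's
identity its quadratic means are bounded by a multiple of `∑ 1 / n²`.

The area of `f(|z| < r)` is at most the integral of the Jacobian `|h'|² - |g'|² ≤ |h'|²`; polar
coordinates and Parseval's identity bound it by `π * areaBound α r`
(`MemPH0.volume_imageDisk_le`). Hence the left side of the inequality is at most
`majorant α r + P N (areaBound α r)`, and this minus `growth α 1` is the function `radiusFun`. The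
latter increases strictly from a negative value to arbitrarily large values, so it has exactly one
root and the inequality holds up to it.

For the extremal mapping the coefficient and area bounds are equalities, and `-growth α 1` is the
boundary value at `-1`, which injectivity excludes from the image. So the distance to the boundary
is at most `growth α 1`, and the inequality fails as soon as `radiusFun` is positive.
-/

open Complex MeasureTheory Set Metric
open scoped Real Topology ComplexConjugate

namespace HarmonicBohr

/-! ### Power series on circles -/

theorem norm_mul_exp_lt_one {r : ℝ} (hr0 : 0 ≤ r) (hr1 : r < 1) (θ : ℝ) :
    ‖(r : ℂ) * exp (θ * I)‖ < 1 := by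
  rwa [norm_mul, norm_exp_ofReal_mul_I, mul_one, norm_real, Real.norm_of_nonneg hr0]

theorem continuous_circle {k : ℂ → ℂ} (hk : ContinuousOn k (ball 0 1)) {r : ℝ} (hr0 : 0 ≤ r)
    (hr1 : r < 1) : Continuous fun θ : ℝ => k (r * exp (θ * I)) :=
  hk.comp_continuous (by fun_prop)
    fun θ => mem_ball_zero_iff.2 (norm_mul_exp_lt_one hr0 hr1 θ)

theorem integral_exp_int_mul (j : ℤ) :
    ∫ θ in (-π)..π, exp (j * θ * I) = if j = 0 then 2 * (π : ℂ) else 0 := by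
  split_ifs with h
  · simp [h]; ring
  · have hc : (j * I : ℂ) ≠ 0 := mul_ne_zero (by exact_mod_cast h) I_ne_zero
    have h2 : ∀ θ : ℝ, exp (j * θ * I) = exp (j * I * θ) := fun θ => by congr 1; ring
    simp_rw [h2]
    rw [integral_exp_mul_complex hc, div_eq_zero_iff]
    left
    rw [sub_eq_zero, exp_eq_exp_iff_exists_int]
    exact ⟨j, by push_cast; ring⟩

/-- Termwise integration over a circle of a power series against a continuous weight. -/
theorem hasSum_integral_circle_mul {k : ℂ → ℂ} {c : ℕ → ℂ}
    (hs : ∀ z : ℂ, ‖z‖ < 1 → HasSum (fun n => c n * z ^ n) (k z))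
    {r : ℝ} (hr0 : 0 ≤ r) (hr1 : r < 1) {q : ℝ → ℂ} (hq : Continuous q) :
    HasSum (fun n => c n * r ^ n * ∫ θ in (-π)..π, exp (n * θ * I) * q θ)
      (∫ θ in (-π)..π, k (r * exp (θ * I)) * q θ) := by
  obtain ⟨B, hB⟩ := (isCompact_uIcc (a := -π) (b := π)).exists_bound_of_continuousOn
    hq.continuousOn
  have hsum : Summable fun n => ‖c n‖ * r ^ n := by
    have := (hs (r : ℂ) (by rwa [norm_real, Real.norm_of_nonneg hr0])).summable.norm
    simpa [abs_of_nonneg hr0] using this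
  have key := intervalIntegral.hasSum_integral_of_dominated_convergence
    (μ := volume) (a := -π) (b := π)
    (F := fun n (θ : ℝ) => c n * r ^ n * (exp (n * θ * I) * q θ))
    (f := fun θ : ℝ => k (r * exp (θ * I)) * q θ)
    (fun n _ => ‖c n‖ * r ^ n * B)
    (fun n => by
      refine Continuous.aestronglyMeasurable ?_
      fun_prop)
    (fun n => Filter.Eventually.of_forall fun θ hθ => by
      have e : ‖exp (n * θ * I)‖ = 1 := by
        rw [← norm_exp_ofReal_mul_I (n * θ)]; push_cast; rfl
      rw [norm_mul, norm_mul, norm_mul, e, one_mul, norm_pow, norm_real,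
        Real.norm_of_nonneg hr0]
      exact mul_le_mul_of_nonneg_left (hB θ (uIoc_subset_uIcc hθ)) (by positivity))
    (Filter.Eventually.of_forall fun θ _ => hsum.mul_right B)
    (by simp)
    (Filter.Eventually.of_forall fun θ _ => by
      have := (hs _ (norm_mul_exp_lt_one hr0 hr1 θ)).mul_right (q θ)
      simp_rw [mul_pow, ← exp_nat_mul] at this
      simpa only [mul_assoc] using this)
  simpa only [intervalIntegral.integral_const_mul] using key

/-- Cauchy's formula for the coefficients, as a Fourier coefficient on a circle. -/
theorem integral_circle_mul_exp {k : ℂ → ℂ} {c : ℕ → ℂ}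
    (hs : ∀ z : ℂ, ‖z‖ < 1 → HasSum (fun n => c n * z ^ n) (k z))
    {r : ℝ} (hr0 : 0 ≤ r) (hr1 : r < 1) (n : ℕ) :
    ∫ θ in (-π)..π, k (r * exp (θ * I)) * exp (-(n * θ * I)) = 2 * π * (c n * r ^ n) := by
  have h := hasSum_integral_circle_mul hs hr0 hr1 (q := fun θ => exp (-(n * θ * I)))
    (by fun_prop)
  refine h.unique ?_
  have h2 : ∀ m : ℕ, ∫ θ in (-π)..π, exp (m * θ * I) * exp (-(n * θ * I))
      = if m = n then 2 * (π : ℂ) else 0 := by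
    intro m
    have := integral_exp_int_mul ((m : ℤ) - n)
    simp only [sub_eq_zero, Int.natCast_inj] at this
    rw [← this]
    congr 1; ext θ
    rw [← exp_add]; push_cast; congr 1; ring
  simp_rw [h2]
  convert hasSum_ite_eq n (2 * π * (c n * r ^ n)) using 2 with m
  split_ifs with hm
  · rw [hm]; ring
  · simp

/-- A power series has no Fourier modes of negative frequency. -/
theorem integral_circle_mul_exp_eq_zero {k : ℂ → ℂ} {c : ℕ → ℂ}
    (hs : ∀ z : ℂ, ‖z‖ < 1 → HasSum (fun n => c n * z ^ n) (k z))
    {r : ℝ} (hr0 : 0 ≤ r) (hr1 : r < 1) {n : ℕ} (hn : n ≠ 0) :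
    ∫ θ in (-π)..π, k (r * exp (θ * I)) * exp (n * θ * I) = 0 := by
  have h := hasSum_integral_circle_mul hs hr0 hr1 (q := fun θ => exp (n * θ * I))
    (by fun_prop)
  refine h.unique ?_
  have h2 : ∀ m : ℕ, ∫ θ in (-π)..π, exp (m * θ * I) * exp (n * θ * I) = 0 := by
    intro m
    have := integral_exp_int_mul ((m : ℤ) + n)
    rw [if_neg (by omega)] at this
    rw [← this]
    congr 1; ext θ
    rw [← exp_add]; push_cast; congr 1; ring
  simp [h2, hasSum_zero]

/-- Parseval's identity on the circle of radius `r`. -/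
theorem hasSum_sq_norm_circle {k : ℂ → ℂ} {c : ℕ → ℂ} (hk : ContinuousOn k (ball 0 1))
    (hs : ∀ z : ℂ, ‖z‖ < 1 → HasSum (fun n => c n * z ^ n) (k z))
    {r : ℝ} (hr0 : 0 ≤ r) (hr1 : r < 1) :
    HasSum (fun n => 2 * π * (‖c n‖ ^ 2 * (r ^ 2) ^ n))
      (∫ θ in (-π)..π, ‖k (r * exp (θ * I))‖ ^ 2) := by
  have h := hasSum_integral_circle_mul hs hr0 hr1 (q := fun θ => conj (k (r * exp (θ * I))))
    (continuous_conj.comp (continuous_circle hk hr0 hr1))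
  rw [← hasSum_ofReal]
  convert h using 1
  · ext n
    have h2 : ∫ θ in (-π)..π, exp (n * θ * I) * conj (k (r * exp (θ * I)))
        = conj (2 * π * (c n * r ^ n)) := by
      rw [← integral_circle_mul_exp hs hr0 hr1 n, ← intervalIntegral.intervalIntegral_conj]
      congr 1; ext θ
      rw [map_mul, ← exp_conj, mul_comm]
      simp
    rw [h2]
    push_cast
    rw [← conj_mul']
    simp only [map_mul, map_pow, conj_ofReal, map_ofNat]
    ring
  · rw [← intervalIntegral.integral_ofReal]
    congr 1; ext θ
    push_cast
    rw [mul_conj']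

/-- Carathéodory's coefficient inequality for functions with real part at least `α`. -/
theorem norm_coeff_le_of_re_ge {k : ℂ → ℂ} {c : ℕ → ℂ} {α : ℝ} (hk : ContinuousOn k (ball 0 1))
    (hs : ∀ z : ℂ, ‖z‖ < 1 → HasSum (fun n => c n * z ^ n) (k z))
    (hre : ∀ z : ℂ, ‖z‖ < 1 → α ≤ (k z).re) (hc0 : c 0 = 1) {n : ℕ} (hn : n ≠ 0) :
    ‖c n‖ ≤ 2 * (1 - α) := by
  have main : ∀ r : ℝ, 0 ≤ r → r < 1 → ‖c n‖ * r ^ n ≤ 2 * (1 - α) := by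
    intro r hr0 hr1
    have hcont := continuous_circle hk hr0 hr1
    have e1 := integral_circle_mul_exp hs hr0 hr1 n
    have e2 : ∫ θ in (-π)..π, conj (k (r * exp (θ * I))) * exp (-(n * θ * I)) = 0 := by
      rw [← map_zero conj, ← integral_circle_mul_exp_eq_zero hs hr0 hr1 hn,
        ← intervalIntegral.intervalIntegral_conj]
      congr 1; ext θ
      rw [map_mul, ← exp_conj]
      simp
    have e3 : ∫ θ in (-π)..π, (2 * α : ℂ) * exp (-(n * θ * I)) = 0 := by
      have := integral_exp_int_mul (-(n : ℤ))
      rw [if_neg (by omega)] at this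
      rw [intervalIntegral.integral_const_mul]
      simp only [Int.cast_neg, Int.cast_natCast, neg_mul] at this
      rw [this, mul_zero]
    have e4 : ∫ θ in (-π)..π, k (r * exp (θ * I)) = 2 * π := by
      simpa [hc0] using integral_circle_mul_exp hs hr0 hr1 0
    have hc1 : Continuous fun θ : ℝ => k (r * exp (θ * I)) * exp (-(n * θ * I)) :=
      hcont.mul (by fun_prop)
    have hc2 : Continuous fun θ : ℝ => conj (k (r * exp (θ * I))) * exp (-(n * θ * I)) :=
      (continuous_conj.comp hcont).mul (by fun_prop)
    have hc3 : Continuous fun θ : ℝ => (k (r * exp (θ * I))).re := continuous_re.comp hcont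
    have hc4 : Continuous fun θ : ℝ => (2 * α : ℂ) * exp (-(n * θ * I)) := by fun_prop
    have i0 : ∀ {E : Type} [NormedAddCommGroup E] {f : ℝ → E}, Continuous f →
      IntervalIntegrable f volume (-π) π := fun hf => hf.intervalIntegrable _ _
    -- `k` may be replaced by `k + conj k - 2 α`, whose other summands have no mode `n`; this real
    -- function is nonnegative, so its `n`-th mode is at most its mean.
    have e5 : 2 * π * (c n * r ^ n) = ∫ θ in (-π)..π,
        (2 * ((k (r * exp (θ * I))).re - α) : ℝ) * exp (-(n * θ * I)) := by
      rw [← e1, ← sub_zero (∫ θ in (-π)..π, k _ * _), ← e3, ← add_zero (∫ θ in (-π)..π, k _ * _),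
        ← e2, ← intervalIntegral.integral_add (i0 hc1) (i0 hc2)]
      erw [← intervalIntegral.integral_sub ((i0 hc1).add (i0 hc2)) (i0 hc4)]
      congr 1; ext θ
      rw [← add_mul, add_conj, ← sub_mul]
      push_cast; ring
    have e6 : ∫ θ in (-π)..π, (2 * ((k (r * exp (θ * I))).re - α) : ℝ)
        = 2 * (2 * π - 2 * π * α) := by
      have e4' : ∫ θ in (-π)..π, (k (r * exp (θ * I))).re = 2 * π := by
        have := reCLM.intervalIntegral_comp_comm (i0 hcont)
        simp only [reCLM_apply] at this
        rw [this, e4]; simp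
      rw [intervalIntegral.integral_const_mul, intervalIntegral.integral_sub
        (i0 hc3) (i0 (by fun_prop)), e4', intervalIntegral.integral_const, smul_eq_mul]
      ring
    have e7 : ‖2 * π * (c n * r ^ n)‖ ≤ 2 * (2 * π - 2 * π * α) := by
      rw [e5, ← e6]
      refine (intervalIntegral.norm_integral_le_integral_norm (by linarith [Real.pi_pos])).trans
        (le_of_eq ?_)
      congr 1; ext θ
      have e : ‖exp (-(n * θ * I))‖ = 1 := by
        rw [← norm_exp_ofReal_mul_I (-(n * θ))]; push_cast; rw [neg_mul]
      rw [norm_mul, e, mul_one, norm_real, Real.norm_of_nonneg]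
      linarith [hre _ (norm_mul_exp_lt_one hr0 hr1 θ)]
    rw [norm_mul, norm_mul, norm_mul, norm_pow, norm_real, norm_real,
      Real.norm_of_nonneg Real.pi_pos.le, Real.norm_of_nonneg hr0, norm_ofNat] at e7
    have := Real.pi_pos
    have h2 : 2 * π * (‖c n‖ * r ^ n) ≤ 2 * π * (2 * (1 - α)) := by linarith
    exact le_of_mul_le_mul_left h2 (by positivity)
  have lim : Filter.Tendsto (fun r : ℝ => ‖c n‖ * r ^ n) (𝓝[<] 1) (𝓝 (‖c n‖ * 1 ^ n)) :=
    Filter.Tendsto.mono_left (Continuous.tendsto (by fun_prop) 1) nhdsWithin_le_nhds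
  rw [one_pow, mul_one] at lim
  refine le_of_tendsto lim ?_
  filter_upwards [Ioo_mem_nhdsLT (show (0 : ℝ) < 1 by norm_num)] with r hr
  exact main r hr.1.le hr.2

/-- Harnack's inequality at the origin for functions with real part at least `α`, obtained from
the Schwarz lemma for `u / (2 (1 - α) - u)`, `u = 1 - k`. -/
theorem re_ge_of_re_ge {k : ℂ → ℂ} {α : ℝ} (hα : α < 1) (hk : DifferentiableOn ℂ k (ball 0 1))
    (hre : ∀ z : ℂ, ‖z‖ < 1 → α ≤ (k z).re) (h0 : k 0 = 1) {z : ℂ} (hz : ‖z‖ < 1) :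
    1 - 2 * (1 - α) * (‖z‖ / (1 + ‖z‖)) ≤ (k z).re := by
  have hle : ∀ w : ℂ, ‖w‖ < 1 → ‖1 - k w‖ ≤ ‖2 * (1 - α) - (1 - k w)‖ ∧
      2 * (1 - α) - (1 - k w) ≠ 0 := by
    intro w hw
    have := hre w hw
    refine ⟨?_, fun h => ?_⟩
    · rw [← sq_le_sq₀ (norm_nonneg _) (norm_nonneg _), ← normSq_eq_norm_sq,
        ← normSq_eq_norm_sq, normSq_apply, normSq_apply]
      simp
      nlinarith
    · have := congrArg re h
      simp at this
      linarith
  have hd : DifferentiableOn ℂ (fun w => (1 - k w) / (2 * (1 - α) - (1 - k w))) (ball 0 1) :=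
    DifferentiableOn.div (by fun_prop) (by fun_prop)
      fun w hw => (hle w (mem_ball_zero_iff.1 hw)).2
  have hS := norm_le_norm_of_mapsTo_ball hd (fun w hw => by
    have := hle w (mem_ball_zero_iff.1 hw)
    rw [mem_closedBall_zero_iff, norm_div]
    exact div_le_one_of_le₀ this.1 (norm_nonneg _)) (by simp [h0]) hz
  have h1 := hle z hz
  have h2 := hre z hz
  rw [norm_div, div_le_iff₀ (norm_pos_iff.2 h1.2)] at hS
  obtain ⟨t, htz⟩ : ∃ t, t = ‖z‖ := ⟨_, rfl⟩
  have ht : 0 ≤ t := htz ▸ norm_nonneg z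
  rw [← htz] at hS hz ⊢
  have h3 : ‖1 - k z‖ ^ 2 ≤ t ^ 2 * ‖2 * (1 - α) - (1 - k z)‖ ^ 2 := by
    rw [← mul_pow]; gcongr
  rw [← normSq_eq_norm_sq (1 - k z), ← normSq_eq_norm_sq (_ - _ : ℂ), normSq_apply,
    normSq_apply] at h3
  simp at h3
  -- Dropping the imaginary parts only helps, as `t ≤ 1`.
  have h4 : (1 - (k z).re) ^ 2 ≤ (t * (2 * (1 - α) - (1 - (k z).re))) ^ 2 := by
    nlinarith [mul_nonneg (sq_nonneg (k z).im) (show 0 ≤ 1 - t ^ 2 by nlinarith)]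
  have h5 := (abs_le_of_sq_le_sq' h4 (mul_nonneg ht (by linarith))).2
  have h6 : (1 - (k z).re) ≤ 2 * (1 - α) * t / (1 + t) := by
    rw [le_div_iff₀ (by linarith)]; linarith
  rw [mul_div_assoc'] ; linarith

/-! ### Taylor coefficients -/

theorem hasSum_taylorCoeff {k : ℂ → ℂ} (hk : DifferentiableOn ℂ k (ball 0 1)) (z : ℂ)
    (hz : ‖z‖ < 1) : HasSum (fun n => taylorCoeff k n * z ^ n) (k z) := by
  have := hasSum_taylorSeries_on_ball (r := 1) (c := 0) (by simpa using hk)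
    (z := z) (by simpa using hz)
  have e : (fun n => taylorCoeff k n * z ^ n) =
      fun n : ℕ => (n.factorial : ℂ)⁻¹ • (z - 0) ^ n • iteratedDeriv n k 0 := by
    ext n
    simp only [taylorCoeff, smul_eq_mul, sub_zero]
    ring
  rw [e]
  exact this

theorem taylorCoeff_deriv (k : ℂ → ℂ) (n : ℕ) :
    taylorCoeff (deriv k) n = (n + 1) * taylorCoeff k (n + 1) := by
  have : (n.factorial : ℂ) ≠ 0 := by exact_mod_cast n.factorial_ne_zero
  have : (n + 1 : ℂ) ≠ 0 := by exact_mod_cast n.succ_ne_zero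
  rw [taylorCoeff, taylorCoeff, iteratedDeriv_succ', Nat.factorial_succ]
  push_cast
  field_simp

/-- Uniqueness of power series coefficients on the unit disk. -/
theorem taylorCoeff_eq_of_hasSum {k : ℂ → ℂ} (hk : DifferentiableOn ℂ k (ball 0 1)) {c : ℕ → ℂ}
    (hs : ∀ z : ℂ, ‖z‖ < 1 → HasSum (fun n => c n * z ^ n) (k z)) (n : ℕ) :
    taylorCoeff k n = c n := by
  have h := (integral_circle_mul_exp (hasSum_taylorCoeff hk) (r := 1 / 2) (by norm_num)
    (by norm_num) n).symm.trans
    (integral_circle_mul_exp hs (r := 1 / 2) (by norm_num) (by norm_num) n)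
  simpa [Real.pi_ne_zero] using h

/-- A rotation of `b` makes the triangle inequality for `a`, `b` an equality. -/
theorem exists_norm_add_mul_eq (a b : ℂ) :
    ∃ ε : ℂ, ‖ε‖ = 1 ∧ ‖a + ε * b‖ = ‖a‖ + ‖b‖ := by
  refine ⟨exp ((arg a - arg b : ℝ) * I), norm_exp_ofReal_mul_I _, ?_⟩
  have : a + exp ((arg a - arg b : ℝ) * I) * b = (‖a‖ + ‖b‖ : ℝ) * exp (arg a * I) := by
    have ha := norm_mul_exp_arg_mul_I a
    have hb := norm_mul_exp_arg_mul_I b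
    have hexp := exp_ne_zero (arg b * I)
    have hb' : b / exp (arg b * I) = ‖b‖ := by rw [div_eq_iff hexp, hb]
    push_cast
    rw [sub_mul, exp_sub, add_mul, ha, div_mul_eq_mul_div, mul_div_assoc, hb', mul_comm (exp _)]
  rw [this, norm_mul, norm_exp_ofReal_mul_I, mul_one, norm_real,
    Real.norm_of_nonneg (by positivity)]

namespace MemPH0

variable {α : ℝ} {h g : ℂ → ℂ}

theorem differentiableOn_deriv_h (m : MemPH0 α h g) : DifferentiableOn ℂ (deriv h) (ball 0 1) :=
  m.analytic_h.deriv isOpen_ball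

theorem differentiableOn_deriv_g (m : MemPH0 α h g) : DifferentiableOn ℂ (deriv g) (ball 0 1) :=
  m.analytic_g.deriv isOpen_ball

/-- All the analytic functions `h' + ε g'`, `|ε| = 1`, have real part at least `α`. -/
theorem le_re_add_mul (m : MemPH0 α h g) {ε : ℂ} (hε : ‖ε‖ = 1) (z : ℂ) (hz : ‖z‖ < 1) :
    α ≤ (deriv h z + ε * deriv g z).re := by
  have h1 := m.re_gt z (mem_ball_zero_iff.2 hz)
  have h2 := abs_le.1 (abs_re_le_norm (ε * deriv g z))
  rw [norm_mul, hε, one_mul] at h2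
  simp only [sub_re, ofReal_re, add_re] at h1 ⊢
  linarith

/-- Carathéodory's inequality for `h' + ε g'`, with `ε` aligning the coefficients of `h` and `g`. -/
theorem coeff_add_le (m : MemPH0 α h g) (n : ℕ) :
    (n + 2 : ℝ) * (‖taylorCoeff h (n + 2)‖ + ‖taylorCoeff g (n + 2)‖) ≤ 2 * (1 - α) := by
  obtain ⟨ε, hε, e⟩ := exists_norm_add_mul_eq (taylorCoeff h (n + 2)) (taylorCoeff g (n + 2))
  have hd := m.differentiableOn_deriv_h
  have gd := m.differentiableOn_deriv_g
  have := norm_coeff_le_of_re_ge (k := fun z => deriv h z + ε * deriv g z)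
    (c := fun n => taylorCoeff (deriv h) n + ε * taylorCoeff (deriv g) n) (α := α)
    (hd.add (gd.const_mul ε)).continuousOn
    (fun z hz => by
      convert (hasSum_taylorCoeff hd z hz).add ((hasSum_taylorCoeff gd z hz).mul_left ε) using 2
      ring)
    (m.le_re_add_mul hε) (by simp [taylorCoeff, m.deriv_h_zero, m.deriv_g_zero])
    (n := n + 1) (by omega)
  rw [← e]
  simp only [taylorCoeff_deriv] at this
  have e2 : ((n + 1 : ℕ) + 1 : ℂ) * taylorCoeff h (n + 1 + 1)
      + ε * (((n + 1 : ℕ) + 1 : ℂ) * taylorCoeff g (n + 1 + 1))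
      = ((n + 2 : ℝ) : ℂ) * (taylorCoeff h (n + 2) + ε * taylorCoeff g (n + 2)) := by
    push_cast; ring
  rw [e2, norm_mul, norm_real, Real.norm_of_nonneg (by positivity)] at this
  exact this

theorem norm_coeff_h_le (m : MemPH0 α h g) (n : ℕ) :
    (n + 2 : ℝ) * ‖taylorCoeff h (n + 2)‖ ≤ 2 * (1 - α) :=
  le_trans (mul_le_mul_of_nonneg_left (le_add_of_nonneg_right (norm_nonneg _)) (by positivity))
    (m.coeff_add_le n)

theorem norm_coeff_g_le (m : MemPH0 α h g) (n : ℕ) :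
    (n + 2 : ℝ) * ‖taylorCoeff g (n + 2)‖ ≤ 2 * (1 - α) :=
  le_trans (mul_le_mul_of_nonneg_left (le_add_of_nonneg_left (norm_nonneg _)) (by positivity))
    (m.coeff_add_le n)

theorem taylorCoeff_h_zero (m : MemPH0 α h g) : taylorCoeff h 0 = 0 := by
  simp [taylorCoeff, m.h_zero]

theorem taylorCoeff_h_one (m : MemPH0 α h g) : taylorCoeff h 1 = 1 := by
  simp [taylorCoeff, m.deriv_h_zero]

theorem taylorCoeff_g_zero (m : MemPH0 α h g) : taylorCoeff g 0 = 0 := by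
  simp [taylorCoeff, m.g_zero]

theorem taylorCoeff_g_one (m : MemPH0 α h g) : taylorCoeff g 1 = 0 := by
  simp [taylorCoeff, m.deriv_g_zero]

end MemPH0

/-! ### The harmonic mapping along lines -/

/-- The component of `h + conj g` in the direction `u`, along a line of direction `u`, has
derivative `Re (|u|² h' + u² g')`. -/
theorem hasDerivAt_re_conj_mul_harmonicMap {h g : ℂ → ℂ} {w u : ℂ} {t : ℝ}
    (hh : DifferentiableAt ℂ h (w + t * u)) (hg : DifferentiableAt ℂ g (w + t * u)) :
    HasDerivAt (fun s : ℝ => (conj u * harmonicMap h g (w + s * u)).re)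
      (‖u‖ ^ 2 * (deriv h (w + t * u)).re + (u ^ 2 * deriv g (w + t * u)).re) t := by
  have hl : HasDerivAt (fun s : ℝ => w + s * u) u t := by
    simpa using ((hasDerivAt_id t).ofReal_comp.mul_const u).const_add w
  have h1 : HasDerivAt (fun s : ℝ => h (w + s * u)) (deriv h (w + t * u) * u) t :=
    HasDerivAt.comp t hh.hasDerivAt hl
  have h2 : HasDerivAt (fun s : ℝ => g (w + s * u)) (deriv g (w + t * u) * u) t :=
    HasDerivAt.comp t hg.hasDerivAt hl
  have h3 := ((h1.add (conjCLE.toContinuousLinearMap.hasFDerivAt.comp_hasDerivAt t h2)).const_mul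
    (conj u))
  have h4 := reCLM.hasFDerivAt.comp_hasDerivAt t h3
  convert! h4 using 1
  rw [← normSq_eq_norm_sq, normSq_apply]
  simp [pow_two]
  ring

/-- If `Re h' > |g'|` on an open segment, then `h + conj g` moves its endpoints apart. -/
theorem harmonicMap_ne_of_segment {h g : ℂ → ℂ} {w u : ℂ} (hu : u ≠ 0)
    (hc : ContinuousOn (fun t : ℝ => harmonicMap h g (w + t * u)) (Icc 0 1))
    (hd : ∀ t ∈ Ioo (0 : ℝ) 1, DifferentiableAt ℂ h (w + t * u) ∧
      DifferentiableAt ℂ g (w + t * u) ∧ ‖deriv g (w + t * u)‖ < (deriv h (w + t * u)).re) :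
    harmonicMap h g (w + u) ≠ harmonicMap h g w := by
  have key : StrictMonoOn (fun s : ℝ => (conj u * harmonicMap h g (w + s * u)).re) (Icc 0 1) := by
    refine strictMonoOn_of_deriv_pos (convex_Icc 0 1)
      (continuous_re.comp_continuousOn (continuousOn_const.mul hc)) fun t ht => ?_
    rw [interior_Icc] at ht
    obtain ⟨h1, h2, h3⟩ := hd t ht
    rw [(hasDerivAt_re_conj_mul_harmonicMap h1 h2).deriv]
    have h4 := abs_le.1 (abs_re_le_norm (u ^ 2 * deriv g (w + t * u)))
    rw [norm_mul, norm_pow] at h4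
    have : 0 < ‖u‖ ^ 2 := by positivity
    nlinarith
  intro e
  have := key (left_mem_Icc.2 zero_le_one) (right_mem_Icc.2 zero_le_one) zero_lt_one
  simp [e] at this

theorem continuousOn_harmonicMap {h g : ℂ → ℂ} {s : Set ℂ} (hh : ContinuousOn h s)
    (hg : ContinuousOn g s) : ContinuousOn (harmonicMap h g) s :=
  hh.add (continuous_conj.comp_continuousOn hg)

/-- The real derivative of `h + conj g`, `w ↦ a w + conj (b w)` with `a = h'`, `b = g'`. -/
noncomputable def realDeriv (a b : ℂ) : ℂ →L[ℝ] ℂ :=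
  (ContinuousLinearMap.toSpanSingleton ℂ a).restrictScalars ℝ +
    conjCLE.toContinuousLinearMap.comp
      ((ContinuousLinearMap.toSpanSingleton ℂ b).restrictScalars ℝ)

theorem realDeriv_apply (a b w : ℂ) : realDeriv a b w = w * a + conj (w * b) := by
  simp [realDeriv]

theorem det_realDeriv (a b : ℂ) : (realDeriv a b).det = ‖a‖ ^ 2 - ‖b‖ ^ 2 := by
  rw [ContinuousLinearMap.det, ← LinearMap.det_toMatrix Complex.basisOneI, Matrix.det_fin_two]
  simp [LinearMap.toMatrix_apply, realDeriv_apply, ← normSq_eq_norm_sq, normSq_apply]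
  ring

theorem surjective_realDeriv {a b : ℂ} (hab : ‖b‖ < ‖a‖) :
    Function.Surjective (realDeriv a b) := by
  refine (LinearMap.injective_iff_surjective (f := (realDeriv a b).toLinearMap)).1 ?_
  rw [injective_iff_map_eq_zero]
  intro w hw
  change realDeriv a b w = 0 at hw
  rw [realDeriv_apply] at hw
  have : ‖w * a‖ = ‖w * b‖ := by rw [eq_neg_of_add_eq_zero_left hw, norm_neg, norm_conj]
  rw [norm_mul, norm_mul] at this
  by_contra h0
  exact hab.ne' (mul_left_cancel₀ (norm_ne_zero_iff.2 h0) this)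

theorem hasStrictFDerivAt_harmonicMap {h g : ℂ → ℂ} {z : ℂ}
    (hh : AnalyticAt ℂ h z) (hg : AnalyticAt ℂ g z) :
    HasStrictFDerivAt (harmonicMap h g) (realDeriv (deriv h z) (deriv g z)) z :=
  (hh.hasStrictDerivAt.hasStrictFDerivAt.restrictScalars ℝ).add
    (conjCLE.toContinuousLinearMap.hasStrictFDerivAt.comp z
      (hg.hasStrictDerivAt.hasStrictFDerivAt.restrictScalars ℝ))

/-! ### Injectivity, openness and growth -/

namespace MemPH0

variable {α : ℝ} {h g : ℂ → ℂ}

theorem analyticAt_h (m : MemPH0 α h g) {z : ℂ} (hz : z ∈ ball (0 : ℂ) 1) : AnalyticAt ℂ h z :=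
  m.analytic_h.analyticAt (isOpen_ball.mem_nhds hz)

theorem analyticAt_g (m : MemPH0 α h g) {z : ℂ} (hz : z ∈ ball (0 : ℂ) 1) : AnalyticAt ℂ g z :=
  m.analytic_g.analyticAt (isOpen_ball.mem_nhds hz)

theorem continuousOn (m : MemPH0 α h g) : ContinuousOn (harmonicMap h g) (ball 0 1) :=
  continuousOn_harmonicMap m.analytic_h.continuousOn m.analytic_g.continuousOn

theorem harmonicMap_zero (m : MemPH0 α h g) : harmonicMap h g 0 = 0 := by
  simp [harmonicMap, m.h_zero, m.g_zero]

theorem norm_deriv_g_lt_re (m : MemPH0 α h g) (hα : 0 ≤ α) {z : ℂ} (hz : z ∈ ball (0 : ℂ) 1) :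
    ‖deriv g z‖ < (deriv h z).re := by
  have := m.re_gt z hz
  simp only [sub_re, ofReal_re] at this
  linarith

theorem injOn (m : MemPH0 α h g) (hα : 0 ≤ α) : InjOn (harmonicMap h g) (ball 0 1) := by
  intro z hz w hw e
  by_contra hne
  have hmem : ∀ t ∈ Icc (0 : ℝ) 1, w + t * (z - w) ∈ ball (0 : ℂ) 1 := fun t ht => by
    have := (convex_ball (0 : ℂ) 1).add_smul_sub_mem hw hz ht
    simpa using this
  refine harmonicMap_ne_of_segment (sub_ne_zero.2 hne)
    (m.continuousOn.comp (by fun_prop) hmem) (fun t ht => ?_) (by rwa [add_sub_cancel])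
  have := hmem t (Ioo_subset_Icc_self ht)
  exact ⟨(m.analyticAt_h this).differentiableAt, (m.analyticAt_g this).differentiableAt,
    m.norm_deriv_g_lt_re hα this⟩

theorem isOpen_imageDisk (m : MemPH0 α h g) (hα : 0 ≤ α) {r : ℝ} (hr : r ≤ 1) :
    IsOpen (imageDisk h g r) := by
  rw [isOpen_iff_mem_nhds]
  rintro _ ⟨z, hz, rfl⟩
  have hz1 := ball_subset_ball hr hz
  have hs := hasStrictFDerivAt_harmonicMap (m.analyticAt_h hz1) (m.analyticAt_g hz1)
  rw [← hs.map_nhds_eq_of_surj (LinearMap.range_eq_top.2 (surjective_realDeriv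
    ((m.norm_deriv_g_lt_re hα hz1).trans_le (re_le_norm _))))]
  exact Filter.image_mem_map (isOpen_ball.mem_nhds hz)

end MemPH0

/-- The sharp lower bound for `|f(z)|` on `|z| = t`. -/
noncomputable def growth (α t : ℝ) : ℝ := t - 2 * (1 - α) * (t - Real.log (1 + t))

theorem hasDerivAt_growth (α : ℝ) {t : ℝ} (ht : 0 ≤ t) :
    HasDerivAt (growth α) (1 - 2 * (1 - α) * (t / (1 + t))) t := by
  have h1 : HasDerivAt (fun t : ℝ => Real.log (1 + t)) (1 / (1 + t)) t :=
    ((hasDerivAt_id t).const_add 1).log (by simp; linarith)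
  have := (hasDerivAt_id t).sub (((hasDerivAt_id t).sub h1).const_mul (2 * (1 - α)))
  convert! this using 1
  have : 1 + t ≠ 0 := by linarith
  field_simp
  ring

theorem growth_monotoneOn {α : ℝ} (hα0 : 0 ≤ α) : MonotoneOn (growth α) (Icc 0 1) := by
  refine monotoneOn_of_deriv_nonneg (convex_Icc 0 1)
    (fun t ht => (hasDerivAt_growth α ht.1).continuousAt.continuousWithinAt)
    (fun t ht => ?_) (fun t ht => ?_)
  · rw [interior_Icc] at ht
    exact (hasDerivAt_growth α ht.1.le).differentiableAt.differentiableWithinAt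
  · rw [interior_Icc] at ht
    rw [(hasDerivAt_growth α ht.1.le).deriv]
    have h1 : t / (1 + t) ≤ 1 / 2 := by
      rw [div_le_div_iff₀ (by linarith [ht.1]) (by norm_num)]; linarith [ht.2]
    have h2 : 0 ≤ t / (1 + t) := div_nonneg ht.1.le (by linarith [ht.1])
    nlinarith

namespace MemPH0

variable {α : ℝ} {h g : ℂ → ℂ}

/-- Along the radius of direction `u`, the component of `f` in the direction `u` grows at the rate
`Re (h' + u² g')`, which Harnack's inequality bounds below by the derivative of `growth`. -/
theorem growth_le_norm (m : MemPH0 α h g) (hα1 : α < 1) {z : ℂ}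
    (hz : z ∈ ball (0 : ℂ) 1) : growth α ‖z‖ ≤ ‖harmonicMap h g z‖ := by
  rw [mem_ball_zero_iff] at hz
  obtain ⟨u, hu, hzu⟩ : ∃ u : ℂ, ‖u‖ = 1 ∧ z = ‖z‖ * u :=
    ⟨exp (arg z * I), norm_exp_ofReal_mul_I _, (norm_mul_exp_arg_mul_I z).symm⟩
  have hmem : ∀ t ∈ Icc 0 ‖z‖, (0 : ℂ) + t * u ∈ ball (0 : ℂ) 1 := fun t ht => by
    rw [zero_add, mem_ball_zero_iff, norm_mul, hu, mul_one, norm_real, Real.norm_of_nonneg ht.1]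
    exact ht.2.trans_lt hz
  have hder : ∀ t ∈ Icc 0 ‖z‖, HasDerivAt
      (fun s : ℝ => (conj u * harmonicMap h g (0 + s * u)).re - growth α s)
      (‖u‖ ^ 2 * (deriv h (0 + t * u)).re + (u ^ 2 * deriv g (0 + t * u)).re
        - (1 - 2 * (1 - α) * (t / (1 + t)))) t := fun t ht =>
    (hasDerivAt_re_conj_mul_harmonicMap (m.analyticAt_h (hmem t ht)).differentiableAt
      (m.analyticAt_g (hmem t ht)).differentiableAt).sub (hasDerivAt_growth α ht.1)
  have key : MonotoneOn (fun s : ℝ => (conj u * harmonicMap h g (0 + s * u)).re - growth α s)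
      (Icc 0 ‖z‖) := by
    refine monotoneOn_of_deriv_nonneg (convex_Icc _ _)
      (fun t ht => (hder t ht).continuousAt.continuousWithinAt)
      (fun t ht => (hder t (interior_subset ht)).differentiableAt.differentiableWithinAt)
      (fun t ht => ?_)
    have ht := interior_subset ht
    rw [(hder t ht).deriv]
    have hε : ‖u ^ 2‖ = 1 := by rw [norm_pow, hu, one_pow]
    have := re_ge_of_re_ge hα1 (m.differentiableOn_deriv_h.add
      (m.differentiableOn_deriv_g.const_mul (u ^ 2))) (m.le_re_add_mul hε)
      (by simp [m.deriv_h_zero, m.deriv_g_zero]) (mem_ball_zero_iff.1 (hmem t ht))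
    have e : ‖(0 : ℂ) + t * u‖ = t := by
      rw [zero_add, norm_mul, hu, mul_one, norm_real, Real.norm_of_nonneg ht.1]
    rw [e] at this
    simp only [Pi.add_apply, add_re] at this
    rw [hu, one_pow, one_mul]
    linarith
  have h1 := key (left_mem_Icc.2 (norm_nonneg z)) (right_mem_Icc.2 (norm_nonneg z)) (norm_nonneg z)
  simp only [zero_add, ← hzu, ofReal_zero, zero_mul, m.harmonicMap_zero, mul_zero, zero_re] at h1
  have h2 : growth α 0 = 0 := by simp [growth]
  have h3 : (conj u * harmonicMap h g z).re ≤ ‖harmonicMap h g z‖ := by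
    refine (re_le_norm _).trans ?_
    rw [norm_mul, norm_conj, hu, one_mul]
  linarith

/-! ### The boundary of the image -/

theorem growth_one_le_norm_of_mem_frontier (m : MemPH0 α h g) (hα0 : 0 ≤ α) (hα1 : α < 1) {w : ℂ}
    (hw : w ∈ frontier (imageDisk h g 1)) : growth α 1 ≤ ‖w‖ := by
  have hopen := m.isOpen_imageDisk hα0 le_rfl
  rw [hopen.frontier_eq] at hw
  have main : ∀ s : ℝ, 0 ≤ s → s < 1 → growth α s ≤ ‖w‖ := by
    intro s hs0 hs1
    -- Split the disk at `|z| = s`: the inner part has compact image inside the open set `f(𝔻)`,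
    -- so `w` is a limit of values taken on the outer part.
    have hsub : imageDisk h g 1 ⊆ harmonicMap h g '' closedBall 0 s ∪ {v | growth α s ≤ ‖v‖} := by
      rintro _ ⟨z, hz, rfl⟩
      rcases le_total ‖z‖ s with hzs | hzs
      · exact Or.inl ⟨z, mem_closedBall_zero_iff.2 hzs, rfl⟩
      · exact Or.inr ((growth_monotoneOn hα0 ⟨hs0, hs1.le⟩
          ⟨norm_nonneg z, (mem_ball_zero_iff.1 hz).le⟩ hzs).trans (m.growth_le_norm hα1 hz))
    have hcl : IsClosed (harmonicMap h g '' closedBall 0 s ∪ {v | growth α s ≤ ‖v‖}) :=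
      ((isCompact_closedBall _ _).image_of_continuousOn
        (m.continuousOn.mono (closedBall_subset_ball hs1))).isClosed.union
        (isClosed_le continuous_const continuous_norm)
    rcases closure_minimal hsub hcl hw.1 with h1 | h1
    · exact absurd (image_mono (closedBall_subset_ball hs1) h1) hw.2
    · exact h1
  refine le_of_tendsto ((hasDerivAt_growth α zero_le_one).continuousAt.tendsto.mono_left
    (nhdsWithin_le_nhds (s := Iio 1))) ?_
  filter_upwards [Ioo_mem_nhdsLT (show (0 : ℝ) < 1 by norm_num)] with s hs
  exact main s hs.1.le hs.2

/-- If the image were the whole plane, `|f|` would be arbitrarily large on suitable circles. -/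
theorem exists_lt_norm_of_imageDisk_eq_univ (m : MemPH0 α h g) (hα0 : 0 ≤ α)
    (hu : imageDisk h g 1 = univ) (R : ℝ) :
    ∃ s : ℝ, 0 ≤ s ∧ s < 1 ∧ ∀ z : ℂ, ‖z‖ = s → R < ‖harmonicMap h g z‖ := by
  -- The open sets `f(|z| < s)` exhaust the plane, so one of them contains the compact disk of
  -- radius `R`; by injectivity, no other point of the unit disk is mapped into that disk.
  have hcover : closedBall (0 : ℂ) R ⊆ ⋃ s : Iio (1 : ℝ), imageDisk h g s := by
    intro w _
    obtain ⟨z, hz, rfl⟩ : w ∈ imageDisk h g 1 := hu ▸ mem_univ w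
    rw [mem_ball_zero_iff] at hz
    obtain ⟨s, hs1, hs2⟩ := exists_between hz
    exact mem_iUnion.2 ⟨⟨s, hs2⟩, z, mem_ball_zero_iff.2 hs1, rfl⟩
  have hdir : Directed (· ⊆ ·) fun s : Iio (1 : ℝ) => imageDisk h g s :=
    Monotone.directed_le fun s t hst => image_mono (ball_subset_ball hst)
  have : Nonempty (Iio (1 : ℝ)) := ⟨⟨0, by simp⟩⟩
  obtain ⟨⟨s, hs⟩, hsR⟩ := (isCompact_closedBall (0 : ℂ) R).elim_directed_cover _
    (fun s => m.isOpen_imageDisk hα0 (le_of_lt s.2)) hcover hdir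
  refine ⟨max s 0, le_max_right _ _, max_lt hs one_pos, fun z hz => ?_⟩
  by_contra! hle
  obtain ⟨y, hy, e⟩ := hsR (mem_closedBall_zero_iff.2 hle)
  have hz1 : z ∈ ball (0 : ℂ) 1 := by
    rw [mem_ball_zero_iff, hz]; exact max_lt hs one_pos
  have := m.injOn hα0 (ball_subset_ball (le_of_lt hs) hy) hz1 e
  subst this
  rw [mem_ball_zero_iff] at hy
  exact absurd (hy.trans_le (le_max_left s 0)) (by rw [hz]; exact lt_irrefl _)

end MemPH0

/-- Functions whose coefficients are `O(1/n)` have bounded quadratic means. -/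
theorem integral_sq_norm_circle_le {k : ℂ → ℂ} (hk : DifferentiableOn ℂ k (ball 0 1))
    (hc : ∀ n : ℕ, ‖taylorCoeff k n‖ ≤ 2 / n) {r : ℝ} (hr0 : 0 ≤ r) (hr1 : r < 1) :
    ∫ θ in (-π)..π, ‖k (r * exp (θ * I))‖ ^ 2 ≤ 2 * π * ∑' n : ℕ, 4 * (1 / (n : ℝ) ^ 2) := by
  refine hasSum_le (fun n => ?_)
    (hasSum_sq_norm_circle hk.continuousOn (hasSum_taylorCoeff hk) hr0 hr1)
    (((Real.summable_one_div_nat_pow.2 one_lt_two).mul_left 4).hasSum.mul_left (2 * π))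
  have h1 : (r ^ 2) ^ n ≤ 1 := pow_le_one₀ (by positivity) (by nlinarith)
  have h2 : ‖taylorCoeff k n‖ ^ 2 ≤ 4 * (1 / (n : ℝ) ^ 2) := by
    calc _ ≤ (2 / (n : ℝ)) ^ 2 := by gcongr; exact hc n
      _ = _ := by rw [div_pow]; ring
  have h3 : ‖taylorCoeff k n‖ ^ 2 * (r ^ 2) ^ n ≤ 4 * (1 / (n : ℝ) ^ 2) :=
    (mul_le_of_le_one_right (by positivity) h1).trans h2
  have := Real.pi_pos
  gcongr

namespace MemPH0

variable {α : ℝ} {h g : ℂ → ℂ}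

theorem imageDisk_one_ne_univ (m : MemPH0 α h g) (hα0 : 0 ≤ α) : imageDisk h g 1 ≠ univ := by
  intro hu
  set B := ∑' n : ℕ, 4 * (1 / (n : ℝ) ^ 2) with hB
  have hB0 : 0 ≤ B := tsum_nonneg fun n => by positivity
  -- On a circle where `|f| > 4 B + 1` the mean of `|f|² ≤ 2 |h|² + 2 |g|²` is at most `4 B`.
  obtain ⟨s, hs0, hs1, hs⟩ := m.exists_lt_norm_of_imageDisk_eq_univ hα0 hu (4 * B + 1)
  have hh : ∀ n : ℕ, ‖taylorCoeff h n‖ ≤ 2 / n := by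
    rintro (_ | _ | n)
    · simp [m.taylorCoeff_h_zero]
    · simp [m.taylorCoeff_h_one]
    · rw [le_div_iff₀ (by positivity)]
      have := m.norm_coeff_h_le n
      push_cast
      linarith
  have hg : ∀ n : ℕ, ‖taylorCoeff g n‖ ≤ 2 / n := by
    rintro (_ | _ | n)
    · simp [m.taylorCoeff_g_zero]
    · simp [m.taylorCoeff_g_one]
    · rw [le_div_iff₀ (by positivity)]
      have := m.norm_coeff_g_le n
      push_cast
      linarith
  have ih := integral_sq_norm_circle_le m.analytic_h hh hs0 hs1
  have ig := integral_sq_norm_circle_le m.analytic_g hg hs0 hs1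
  have ch : Continuous fun θ : ℝ => ‖h (s * exp (θ * I))‖ ^ 2 :=
    (continuous_circle m.analytic_h.continuousOn hs0 hs1).norm.pow 2
  have cg : Continuous fun θ : ℝ => ‖g (s * exp (θ * I))‖ ^ 2 :=
    (continuous_circle m.analytic_g.continuousOn hs0 hs1).norm.pow 2
  have hle : ∫ θ in (-π)..π, (4 * B + 1) ^ 2 ≤ ∫ θ in (-π)..π,
      (2 * ‖h (s * exp (θ * I))‖ ^ 2 + 2 * ‖g (s * exp (θ * I))‖ ^ 2) := by
    refine intervalIntegral.integral_mono_on (by linarith [Real.pi_pos]) (by simp)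
      (((ch.const_mul 2).add (cg.const_mul 2)).intervalIntegrable _ _) fun θ _ => ?_
    have h1 := hs (s * exp (θ * I)) (by
      rw [norm_mul, norm_exp_ofReal_mul_I, mul_one, norm_real, Real.norm_of_nonneg hs0])
    have h2 := norm_add_le (h (s * exp (θ * I))) (conj (g (s * exp (θ * I))))
    rw [norm_conj] at h2
    have h3 : 4 * B + 1 ≤ ‖h (s * exp (θ * I))‖ + ‖g (s * exp (θ * I))‖ := h1.le.trans h2
    have h4 := pow_le_pow_left₀ (by linarith) h3 2
    nlinarith [sq_nonneg (‖h (s * exp (θ * I))‖ - ‖g (s * exp (θ * I))‖)]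
  rw [intervalIntegral.integral_add ((ch.const_mul 2).intervalIntegrable _ _)
    ((cg.const_mul 2).intervalIntegrable _ _), intervalIntegral.integral_const_mul,
    intervalIntegral.integral_const_mul, intervalIntegral.integral_const, smul_eq_mul] at hle
  have hfin : 2 * π * (4 * B + 1) ^ 2 ≤ 2 * π * (4 * B) := by linarith
  have := le_of_mul_le_mul_left hfin (by positivity)
  nlinarith

theorem frontier_nonempty (m : MemPH0 α h g) (hα0 : 0 ≤ α) :
    (frontier (imageDisk h g 1)).Nonempty :=
  nonempty_frontier_iff.2 ⟨⟨_, 0, by simp, rfl⟩, m.imageDisk_one_ne_univ hα0⟩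

theorem growth_one_le_distBoundary (m : MemPH0 α h g) (hα0 : 0 ≤ α) (hα1 : α < 1) :
    growth α 1 ≤ distBoundary h g := by
  refine (le_infDist (m.frontier_nonempty hα0)).2 fun w hw => ?_
  rw [m.harmonicMap_zero, dist_zero_left]
  exact m.growth_one_le_norm_of_mem_frontier hα0 hα1 hw

end MemPH0

/-! ### Area -/

/-- Integration over a disk in polar coordinates. -/
theorem lintegral_ball_sq_norm {k : ℂ → ℂ} (hk : ContinuousOn k (ball 0 1)) {r : ℝ}
    (hr1 : r < 1) :
    ∫⁻ z in ball 0 r, ENNReal.ofReal (‖k z‖ ^ 2) =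
      ∫⁻ s in Ioo 0 r, ENNReal.ofReal (s * ∫ θ in (-π)..π, ‖k (s * exp (θ * I))‖ ^ 2) := by
  have hmeas : Measurable ((ball (0 : ℂ) r).indicator fun z => ENNReal.ofReal (‖k z‖ ^ 2)) := by
    have hc : ContinuousOn (fun z => ENNReal.ofReal (‖k z‖ ^ 2)) (ball (0 : ℂ) r) :=
      ENNReal.continuous_ofReal.comp_continuousOn
        ((hk.mono (ball_subset_ball hr1.le)).norm.pow 2)
    classical
    rw [← piecewise_eq_indicator]
    exact hc.measurable_piecewise continuousOn_const measurableSet_ball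
  have hsymm : ∀ s θ : ℝ, Complex.polarCoord.symm (s, θ) = s * exp (θ * I) := fun s θ => by
    rw [Complex.polarCoord_symm_apply, exp_mul_I]; push_cast; rfl
  have hsymm_cont : Continuous fun p : ℝ × ℝ => Complex.polarCoord.symm p := by
    have : (fun p : ℝ × ℝ => Complex.polarCoord.symm p) = fun p => p.1 * exp (p.2 * I) := by
      ext p : 1; exact hsymm p.1 p.2
    rw [this]; fun_prop
  rw [← lintegral_indicator measurableSet_ball, ← Complex.lintegral_comp_polarCoord_symm,
    polarCoord_target, Measure.volume_eq_prod, setLIntegral_prod _ (by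
      refine Measurable.aemeasurable ?_
      simp only [smul_eq_mul]
      exact (ENNReal.measurable_ofReal.comp measurable_fst).mul
        (hmeas.comp hsymm_cont.measurable))]
  have hinner : ∀ s ∈ Ioi (0 : ℝ),
      ∫⁻ θ in Ioo (-π) π, ENNReal.ofReal s • (ball (0 : ℂ) r).indicator
        (fun z => ENNReal.ofReal (‖k z‖ ^ 2)) (Complex.polarCoord.symm (s, θ)) =
      (Iio r).indicator
        (fun s => ENNReal.ofReal (s * ∫ θ in (-π)..π, ‖k (s * exp (θ * I))‖ ^ 2)) s := by
    intro s hs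
    have hs0 : 0 ≤ s := le_of_lt hs
    have hmem : ∀ θ : ℝ, (s : ℂ) * exp (θ * I) ∈ ball (0 : ℂ) r ↔ s < r := fun θ => by
      rw [mem_ball_zero_iff, norm_mul, norm_exp_ofReal_mul_I, mul_one, norm_real,
        Real.norm_of_nonneg hs0]
    simp only [hsymm, indicator, hmem, mem_Iio]
    split_ifs with hsr
    · have hc : Continuous fun θ : ℝ => ‖k (s * exp (θ * I))‖ ^ 2 :=
        (continuous_circle hk hs0 (hsr.trans hr1)).norm.pow 2
      simp only [smul_eq_mul]
      rw [lintegral_const_mul' _ _ ENNReal.ofReal_ne_top, ENNReal.ofReal_mul hs0,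
        intervalIntegral.integral_of_le (by linarith [Real.pi_pos]), integral_Ioc_eq_integral_Ioo,
        ofReal_integral_eq_lintegral_ofReal
          ((hc.integrableOn_Icc (a := -π) (b := π)).mono_set Ioo_subset_Icc_self)
          (Filter.Eventually.of_forall fun θ => by positivity)]
    · simp
  rw [setLIntegral_congr_fun measurableSet_Ioi hinner, setLIntegral_indicator measurableSet_Iio,
    inter_comm, Ioi_inter_Iio]

/-- The closed form of `r² + ∑_{n ≥ 2} n (2 (1 - α) / n)² r^{2n}`. -/
noncomputable def areaBound (α r : ℝ) : ℝ :=
  r ^ 2 - 4 * (1 - α) ^ 2 * (r ^ 2 + Real.log (1 - r ^ 2))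

theorem hasDerivAt_areaBound (α : ℝ) {r : ℝ} (hr0 : 0 ≤ r) (hr1 : r < 1) :
    HasDerivAt (areaBound α) (2 * r * (1 + 4 * (1 - α) ^ 2 * (r ^ 2 / (1 - r ^ 2)))) r := by
  have h0 : 1 - r ^ 2 ≠ 0 := by nlinarith
  have h1 : HasDerivAt (fun r : ℝ => r ^ 2) (2 * r) r := by simpa using hasDerivAt_pow 2 r
  have := h1.sub ((h1.add ((h1.const_sub 1).log h0)).const_mul (4 * (1 - α) ^ 2))
  convert! this using 1
  field_simp
  ring

theorem areaBound_zero (α : ℝ) : areaBound α 0 = 0 := by simp [areaBound]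

/-- Radial integration of the extremal quadratic means. -/
theorem lintegral_Ioo_areaBound (α : ℝ) {r : ℝ} (hr0 : 0 ≤ r) (hr1 : r < 1) :
    ∫⁻ s in Ioo 0 r,
      ENNReal.ofReal (s * (2 * π * (1 + 4 * (1 - α) ^ 2 * (s ^ 2 / (1 - s ^ 2))))) =
      ENNReal.ofReal (π * areaBound α r) := by
  have hc : ContinuousOn (fun s : ℝ => s * (2 * π * (1 + 4 * (1 - α) ^ 2 * (s ^ 2 / (1 - s ^ 2)))))
      (Icc 0 r) := by
    have : ∀ s ∈ Icc 0 r, 1 - s ^ 2 ≠ 0 := fun s hs => by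
      have := hs.1; have := hs.2; nlinarith
    fun_prop (disch := assumption)
  have hI : ∫ s in (0 : ℝ)..r, s * (2 * π * (1 + 4 * (1 - α) ^ 2 * (s ^ 2 / (1 - s ^ 2))))
      = π * areaBound α r := by
    have := intervalIntegral.integral_eq_sub_of_hasDerivAt (a := 0) (b := r)
      (f := fun s => π * areaBound α s)
      (f' := fun s => s * (2 * π * (1 + 4 * (1 - α) ^ 2 * (s ^ 2 / (1 - s ^ 2)))))
      (fun s hs => by
        rw [uIcc_of_le hr0] at hs
        convert! (hasDerivAt_areaBound α hs.1 (hs.2.trans_lt hr1)).const_mul π using 1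
        ring)
      (hc.intervalIntegrable_of_Icc hr0)
    rw [this, areaBound_zero, mul_zero, sub_zero]
  rw [← hI, intervalIntegral.integral_of_le hr0, integral_Ioc_eq_integral_Ioo,
    ofReal_integral_eq_lintegral_ofReal (hc.integrableOn_Icc.mono_set Ioo_subset_Icc_self)]
  filter_upwards [self_mem_ae_restrict measurableSet_Ioo] with s hs
  have h1 := hs.1
  have h2 : 0 < 1 - s ^ 2 := by nlinarith [hs.2]
  have := Real.pi_pos
  simp only [Pi.zero_apply]
  positivity

/-- Quadratic means when the coefficients are those of the extremal derivative. -/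
theorem hasSum_extremal_sq (α : ℝ) {s : ℝ} (hs0 : 0 ≤ s) (hs1 : s < 1) :
    HasSum (fun n : ℕ => 2 * π * ((if n = 0 then 1 else 2 * (1 - α)) ^ 2 * (s ^ 2) ^ n))
      (2 * π * (1 + 4 * (1 - α) ^ 2 * (s ^ 2 / (1 - s ^ 2)))) := by
  refine HasSum.mul_left _ ?_
  have h2 : s ^ 2 < 1 := by nlinarith
  have h3 : (1 - s ^ 2) ≠ 0 := by linarith
  rw [← hasSum_nat_add_iff' 1]
  convert! (hasSum_geometric_of_lt_one (sq_nonneg s) h2).mul_left (4 * (1 - α) ^ 2 * s ^ 2) using 1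
  · ext n
    rw [if_neg n.succ_ne_zero]
    ring
  · rw [Finset.sum_range_one, if_pos rfl]
    field_simp
    ring

namespace MemPH0

variable {α : ℝ} {h g : ℂ → ℂ}

theorem norm_taylorCoeff_deriv_le (m : MemPH0 α h g) (n : ℕ) :
    ‖taylorCoeff (deriv h) n‖ ≤ if n = 0 then 1 else 2 * (1 - α) := by
  rcases n with _ | n
  · simp [taylorCoeff_deriv, m.taylorCoeff_h_one]
  · have := m.norm_coeff_h_le n
    rw [if_neg (by omega), taylorCoeff_deriv, norm_mul]
    have e : ‖((n + 1 : ℕ) + 1 : ℂ)‖ = n + 2 := by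
      rw [show ((n + 1 : ℕ) + 1 : ℂ) = ((n + 2 : ℕ) : ℂ) by push_cast; ring, norm_natCast]
      push_cast; rfl
    rwa [e]

theorem hasFDerivWithinAt (m : MemPH0 α h g) {r : ℝ} (hr : r ≤ 1) :
    ∀ z ∈ ball (0 : ℂ) r, HasFDerivWithinAt (harmonicMap h g)
      (realDeriv (deriv h z) (deriv g z)) (ball 0 r) z := fun _ hz =>
  (hasStrictFDerivAt_harmonicMap (m.analyticAt_h (ball_subset_ball hr hz))
    (m.analyticAt_g (ball_subset_ball hr hz))).hasFDerivAt.hasFDerivWithinAt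

/-- The area is at most the integral of the Jacobian, hence of `|h'|²`, which the coefficient
bounds control through Parseval's identity. -/
theorem volume_imageDisk_le (m : MemPH0 α h g) (hα0 : 0 ≤ α) {r : ℝ} (hr0 : 0 ≤ r)
    (hr1 : r < 1) : volume (imageDisk h g r) ≤ ENNReal.ofReal (π * areaBound α r) := by
  have hd := m.differentiableOn_deriv_h
  calc volume (imageDisk h g r)
      ≤ ∫⁻ z in ball 0 r, ENNReal.ofReal |(realDeriv (deriv h z) (deriv g z)).det| :=
        addHaar_image_le_lintegral_abs_det_fderiv volume measurableSet_ball
          (m.hasFDerivWithinAt hr1.le)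
    _ ≤ ∫⁻ z in ball 0 r, ENNReal.ofReal (‖deriv h z‖ ^ 2) := by
        refine setLIntegral_mono' measurableSet_ball fun z hz => ENNReal.ofReal_le_ofReal ?_
        have h1 := (m.norm_deriv_g_lt_re hα0 (ball_subset_ball hr1.le hz)).trans_le (re_le_norm _)
        have h2 := norm_nonneg (deriv g z)
        rw [det_realDeriv, abs_of_nonneg (by nlinarith)]
        nlinarith
    _ = _ := lintegral_ball_sq_norm hd.continuousOn hr1
    _ ≤ ∫⁻ s in Ioo 0 r,
        ENNReal.ofReal (s * (2 * π * (1 + 4 * (1 - α) ^ 2 * (s ^ 2 / (1 - s ^ 2))))) := by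
        refine setLIntegral_mono' measurableSet_Ioo fun s hs => ENNReal.ofReal_le_ofReal ?_
        refine mul_le_mul_of_nonneg_left ?_ hs.1.le
        refine hasSum_le (fun n => ?_) (hasSum_sq_norm_circle hd.continuousOn
          (hasSum_taylorCoeff hd) hs.1.le (hs.2.trans hr1))
          (hasSum_extremal_sq α hs.1.le (hs.2.trans hr1))
        have := m.norm_taylorCoeff_deriv_le n
        have := Real.pi_pos
        gcongr
    _ = _ := lintegral_Ioo_areaBound α hr0 hr1

end MemPH0

/-! ### The radius -/

theorem areaBound_monotoneOn (α : ℝ) : MonotoneOn (areaBound α) (Ico 0 1) := by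
  refine monotoneOn_of_deriv_nonneg (convex_Ico 0 1)
    (fun t ht => (hasDerivAt_areaBound α ht.1 ht.2).continuousAt.continuousWithinAt)
    (fun t ht => ?_) (fun t ht => ?_)
  · have ht := interior_subset ht
    exact (hasDerivAt_areaBound α ht.1 ht.2).differentiableAt.differentiableWithinAt
  · have ht := interior_subset ht
    rw [(hasDerivAt_areaBound α ht.1 ht.2).deriv]
    have h1 := ht.1
    have h2 : 0 < 1 - t ^ 2 := by nlinarith [ht.2]
    positivity

theorem areaBound_nonneg (α : ℝ) {r : ℝ} (hr : r ∈ Ico (0 : ℝ) 1) : 0 ≤ areaBound α r := by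
  rw [← areaBound_zero α]
  exact areaBound_monotoneOn α ⟨le_rfl, one_pos⟩ hr hr.1

theorem P_mono (N : ℕ) {x y : ℝ} (hx : 0 ≤ x) (hxy : x ≤ y) : P N x ≤ P N y :=
  Finset.sum_le_sum fun _ _ => by gcongr

theorem P_nonneg (N : ℕ) {x : ℝ} (hx : 0 ≤ x) : 0 ≤ P N x :=
  Finset.sum_nonneg fun _ _ => by positivity

/-- The closed form of `r + ∑_{n ≥ 2} (2 (1 - α) / n) r^n`. -/
noncomputable def majorant (α r : ℝ) : ℝ := r + 2 * (1 - α) * (-Real.log (1 - r) - r)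

theorem hasDerivAt_majorant (α : ℝ) {r : ℝ} (hr1 : r < 1) :
    HasDerivAt (majorant α) (1 + 2 * (1 - α) * (r / (1 - r))) r := by
  have h0 : 1 - r ≠ 0 := by linarith
  have h1 := (hasDerivAt_id r).add
    (((((hasDerivAt_id r).const_sub 1).log h0).neg.sub (hasDerivAt_id r)).const_mul (2 * (1 - α)))
  convert! h1 using 1
  simp only [id]
  field_simp
  ring

theorem majorant_strictMonoOn {α : ℝ} (hα1 : α < 1) : StrictMonoOn (majorant α) (Ico 0 1) := by
  refine strictMonoOn_of_deriv_pos (convex_Ico 0 1)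
    (fun t ht => (hasDerivAt_majorant α ht.2).continuousAt.continuousWithinAt) fun t ht => ?_
  have ht := interior_subset ht
  rw [(hasDerivAt_majorant α ht.2).deriv]
  have h1 : 0 ≤ t / (1 - t) := div_nonneg ht.1 (by linarith [ht.2])
  have h2 : 0 < 1 - α := by linarith
  positivity

/-- `radiusFun` is the Bohr sum of the extremal mapping minus its distance to the boundary. -/
theorem radiusFun_eq (N : ℕ) (α : ℝ) {r : ℝ} (hr1 : r < 1) :
    radiusFun N α r = majorant α r + P N (areaBound α r) - growth α 1 := by
  have : Real.log (2 - 2 * r) = Real.log 2 + Real.log (1 - r) := by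
    rw [← Real.log_mul (by norm_num) (by linarith)]; ring_nf
  rw [radiusFun, this, majorant, growth, areaBound, one_add_one_eq_two]
  ring

/-- Strict monotonicity makes the root of `radiusFun` unique and fixes the sign on either side. -/
theorem radiusFun_strictMonoOn (N : ℕ) {α : ℝ} (hα1 : α < 1) :
    StrictMonoOn (radiusFun N α) (Ico 0 1) := by
  intro r hr s hs hrs
  rw [radiusFun_eq N α hr.2, radiusFun_eq N α hs.2]
  have h1 := majorant_strictMonoOn hα1 hr hs hrs
  have h2 := P_mono N (areaBound_nonneg α hr) (areaBound_monotoneOn α hr hs hrs.le)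
  linarith

theorem growth_one_pos {α : ℝ} (hα0 : 0 ≤ α) : 0 < growth α 1 := by
  rw [growth, one_add_one_eq_two]
  have := Real.log_two_gt_d9
  have := Real.log_two_lt_d9
  nlinarith

theorem exists_radiusFun_eq_zero (N : ℕ) {α : ℝ} (hα0 : 0 ≤ α) (hα1 : α < 1) :
    ∃ ρ ∈ Ioo (0 : ℝ) 1, radiusFun N α ρ = 0 := by
  have hpos : 0 < 1 - α := by linarith
  have h0 : radiusFun N α 0 < 0 := by
    rw [radiusFun_eq N α one_pos, areaBound_zero]
    have hP : P N 0 = 0 := Finset.sum_eq_zero fun k hk => by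
      rw [zero_pow]; have := (Finset.mem_Icc.1 hk).1; omega
    have := growth_one_pos hα0
    simp [hP, majorant]
    linarith
  -- At `R` the logarithm `log (2 - 2 R)` equals `-1 / (1 - α)`.
  set R := 1 - Real.exp (-(1 / (1 - α))) / 2 with hR
  have hexp : Real.exp (-(1 / (1 - α))) ≤ 1 := by
    rw [Real.exp_le_one_iff, neg_nonpos]; positivity
  have hexp0 := Real.exp_pos (-(1 / (1 - α)))
  have hR0 : 0 < R := by linarith
  have hR1 : R < 1 := by linarith
  have h1 : 0 < radiusFun N α R := by
    have hA := P_nonneg N (areaBound_nonneg α ⟨hR0.le, hR1⟩)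
    have hl : Real.log (2 - 2 * R) = -(1 / (1 - α)) := by
      rw [show 2 - 2 * R = Real.exp (-(1 / (1 - α))) by rw [hR]; ring, Real.log_exp]
    rw [radiusFun, hl]
    change 0 ≤ P N (R ^ 2 - 4 * (1 - α) ^ 2 * (R ^ 2 + Real.log (1 - R ^ 2))) at hA
    have : 2 * (1 - α) * (R - 1 + -(1 / (1 - α))) = 2 * (1 - α) * (R - 1) - 2 := by
      field_simp; ring
    rw [this]
    nlinarith
  have hcont : ContinuousOn (radiusFun N α) (Icc 0 R) := by
    have h2 : ContinuousOn (fun r => majorant α r + P N (areaBound α r) - growth α 1)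
        (Icc 0 R) := by
      refine ContinuousOn.sub (ContinuousOn.add (fun r hr => ?_) ?_) continuousOn_const
      · exact (hasDerivAt_majorant α (hr.2.trans_lt hR1)).continuousAt.continuousWithinAt
      · unfold P
        refine continuousOn_finsetSum _ fun k _ => ContinuousOn.pow (fun r hr => ?_) k
        exact (hasDerivAt_areaBound α hr.1 (hr.2.trans_lt hR1)).continuousAt.continuousWithinAt
    exact h2.congr fun r hr => radiusFun_eq N α (hr.2.trans_lt hR1)
  obtain ⟨ρ, hρ, e⟩ := intermediate_value_Ioo hR0.le hcont ⟨h0, h1⟩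
  exact ⟨ρ, ⟨hρ.1, hρ.2.trans hR1⟩, e⟩

/-! ### The Bohr sum -/

theorem hasSum_majorant (α : ℝ) {r : ℝ} (hr0 : 0 ≤ r) (hr1 : r < 1) :
    HasSum (fun n : ℕ => 2 * (1 - α) / (n + 2) * r ^ (n + 2)) (majorant α r - r) := by
  have h1 := Real.hasSum_pow_div_log_of_abs_lt_one (x := r) (by rwa [abs_of_nonneg hr0])
  rw [← hasSum_nat_add_iff' 1] at h1
  convert! h1.mul_left (2 * (1 - α)) using 1
  · ext n
    push_cast
    rw [add_assoc n 1 1, add_assoc (n : ℝ), one_add_one_eq_two, one_add_one_eq_two]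
    ring
  · simp [majorant]

namespace MemPH0

variable {α : ℝ} {h g : ℂ → ℂ}

theorem bohrTerm_le (m : MemPH0 α h g) {r : ℝ} (hr0 : 0 ≤ r) (n : ℕ) :
    bohrTerm h g r (n + 2) ≤ 2 * (1 - α) / (n + 2) * r ^ (n + 2) := by
  refine mul_le_mul_of_nonneg_right ?_ (by positivity)
  rw [le_div_iff₀ (by positivity), mul_comm]
  exact m.coeff_add_le n

theorem summable_bohrTerm (m : MemPH0 α h g) {r : ℝ} (hr0 : 0 ≤ r) (hr1 : r < 1) :
    Summable fun n : ℕ => bohrTerm h g r (n + 2) :=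
  (hasSum_majorant α hr0 hr1).summable.of_nonneg_of_le
    (fun n => mul_nonneg (by positivity) (by positivity)) (m.bohrTerm_le hr0)

theorem bohrSum_le (m : MemPH0 α h g) (N : ℕ) (hα0 : 0 ≤ α) {r : ℝ} (hr0 : 0 ≤ r) (hr1 : r < 1) :
    bohrSum N h g r ≤ majorant α r + P N (areaBound α r) := by
  have h1 := hasSum_le (m.bohrTerm_le hr0) (m.summable_bohrTerm hr0 hr1).hasSum
    (hasSum_majorant α hr0 hr1)
  have h2 : area h g r / π ≤ areaBound α r := by
    rw [div_le_iff₀ Real.pi_pos, mul_comm]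
    exact ENNReal.toReal_le_of_le_ofReal
      (mul_nonneg Real.pi_pos.le (areaBound_nonneg α ⟨hr0, hr1⟩))
      (m.volume_imageDisk_le hα0 hr0 hr1)
  have h3 := P_mono N (div_nonneg ENNReal.toReal_nonneg Real.pi_pos.le) h2
  rw [bohrSum]
  change P N (area h g r / π) ≤ _ at h3
  linarith

end MemPH0

/-! ### The extremal mapping -/

/-- The extremal analytic function `z + ∑_{n ≥ 2} (2 (1 - α) / n) z^n`, whose derivative
`1 + 2 (1 - α) z / (1 - z)` maps the disk onto the half-plane `Re w > α`. -/
noncomputable def extremal (α : ℝ) (z : ℂ) : ℂ := z + 2 * (1 - α) * (-log (1 - z) - z)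

theorem one_sub_mem_slitPlane {z : ℂ} (hz : z.re < 1) : 1 - z ∈ slitPlane := by
  left; simpa using hz

theorem hasDerivAt_extremal (α : ℝ) {z : ℂ} (hz : z.re < 1) :
    HasDerivAt (extremal α) (1 + 2 * (1 - α) * (z / (1 - z))) z := by
  have hs := one_sub_mem_slitPlane hz
  have h0 := slitPlane_ne_zero hs
  have h1 := (hasDerivAt_id z).add (((((hasDerivAt_id z).const_sub 1).clog hs).neg.sub
    (hasDerivAt_id z)).const_mul (2 * (1 - α : ℂ)))
  convert! h1 using 1
  simp only [id]
  field_simp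
  ring

theorem re_lt_one_of_mem_ball {z : ℂ} (hz : z ∈ ball (0 : ℂ) 1) : z.re < 1 :=
  (re_le_norm z).trans_lt (mem_ball_zero_iff.1 hz)

theorem lt_re_deriv_extremal {α : ℝ} (hα1 : α < 1) {z : ℂ} (hz : z ∈ ball (0 : ℂ) 1) :
    α < (deriv (extremal α) z).re := by
  have hre := re_lt_one_of_mem_ball hz
  rw [(hasDerivAt_extremal α hre).deriv]
  have hn : normSq z < 1 := by
    rw [normSq_eq_norm_sq]
    have := mem_ball_zero_iff.1 hz
    nlinarith [norm_nonneg z]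
  have hp : 0 < normSq (1 - z) :=
    normSq_pos.2 (slitPlane_ne_zero (one_sub_mem_slitPlane hre))
  have h1 : -(1 / 2) < (z / (1 - z)).re := by
    rw [div_re, ← add_div, lt_div_iff₀ hp]
    rw [normSq_apply] at hn ⊢
    simp
    nlinarith
  have e : (1 + 2 * (1 - α) * (z / (1 - z)) : ℂ).re = 1 + 2 * (1 - α) * (z / (1 - z)).re := by
    rw [show (2 * (1 - α) : ℂ) = ((2 * (1 - α) : ℝ) : ℂ) by push_cast; ring, add_re, one_re,
      re_ofReal_mul]
  rw [e]
  nlinarith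

theorem memPH0_extremal {α : ℝ} (hα1 : α < 1) : MemPH0 α (extremal α) 0 where
  analytic_h z hz :=
    (hasDerivAt_extremal α (re_lt_one_of_mem_ball hz)).differentiableAt.differentiableWithinAt
  analytic_g := differentiableOn_const 0
  h_zero := by simp [extremal]
  deriv_h_zero := by rw [(hasDerivAt_extremal α (by simp)).deriv]; simp
  g_zero := rfl
  deriv_g_zero := by simp
  re_gt z hz := by
    have := lt_re_deriv_extremal hα1 hz
    simpa using this

theorem taylorCoeff_extremal {α : ℝ} (hα1 : α < 1) (n : ℕ) :
    taylorCoeff (extremal α) (n + 2) = (2 * (1 - α) / (n + 2) : ℝ) := by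
  have h1 := taylorCoeff_eq_of_hasSum (memPH0_extremal hα1).analytic_h
    (c := fun n : ℕ => (if n = 1 then 1 else 0) + 2 * (1 - α) * (1 / n - if n = 1 then 1 else 0))
    (fun z hz => by
      have hid : HasSum (fun n : ℕ => (if n = 1 then 1 else 0) * z ^ n) z := by
        convert! hasSum_ite_eq 1 z using 1
        ext n
        split_ifs with hn
        · rw [hn]; ring
        · ring
      have := hid.add (((hasSum_taylorSeries_neg_log hz).sub hid).mul_left (2 * (1 - α : ℂ)))
      convert! this using 1
      ext n
      ring) (n + 2)
  rw [h1]
  simp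
  ring

theorem norm_taylorCoeff_deriv_extremal {α : ℝ} (hα1 : α < 1) (n : ℕ) :
    ‖taylorCoeff (deriv (extremal α)) n‖ = if n = 0 then 1 else 2 * (1 - α) := by
  rcases n with _ | n
  · simp [taylorCoeff_deriv, (memPH0_extremal hα1).taylorCoeff_h_one]
  · rw [if_neg (by omega), taylorCoeff_deriv, taylorCoeff_extremal hα1]
    have h2 : (n + 2 : ℂ) ≠ 0 := by exact_mod_cast (by omega : n + 2 ≠ 0)
    have : ((n + 1 : ℕ) + 1 : ℂ) * (2 * (1 - α) / (n + 2) : ℝ) = (2 * (1 - α) : ℝ) := by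
      push_cast
      rw [add_assoc (n : ℂ), one_add_one_eq_two]
      field_simp
    rw [this, norm_real, Real.norm_of_nonneg (by linarith)]

/-- For the extremal mapping the area formula is an equality by injectivity. -/
theorem area_extremal {α : ℝ} (hα0 : 0 ≤ α) (hα1 : α < 1) {r : ℝ} (hr0 : 0 ≤ r) (hr1 : r < 1) :
    area (extremal α) 0 r = π * areaBound α r := by
  have m := memPH0_extremal hα1
  have hd := m.differentiableOn_deriv_h
  have : volume (imageDisk (extremal α) 0 r) = ENNReal.ofReal (π * areaBound α r) := by
    rw [imageDisk, ← lintegral_abs_det_fderiv_eq_addHaar_image volume measurableSet_ball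
      (m.hasFDerivWithinAt hr1.le) ((m.injOn hα0).mono (ball_subset_ball hr1.le)),
      ← lintegral_Ioo_areaBound α hr0 hr1]
    have e : ∀ z, |(realDeriv (deriv (extremal α) z) (deriv 0 z)).det|
        = ‖deriv (extremal α) z‖ ^ 2 := fun z => by
      rw [det_realDeriv]; simp
    simp only [e]
    rw [lintegral_ball_sq_norm hd.continuousOn hr1]
    refine setLIntegral_congr_fun measurableSet_Ioo fun s hs => ?_
    have h1 := hasSum_sq_norm_circle hd.continuousOn (hasSum_taylorCoeff hd) hs.1.le
      (hs.2.trans hr1)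
    simp only [norm_taylorCoeff_deriv_extremal hα1] at h1
    simp only [h1.unique (hasSum_extremal_sq α hs.1.le (hs.2.trans hr1))]
  rw [area, this, ENNReal.toReal_ofReal
    (mul_nonneg Real.pi_pos.le (areaBound_nonneg α ⟨hr0, hr1⟩))]

theorem bohrSum_extremal (N : ℕ) {α : ℝ} (hα0 : 0 ≤ α) (hα1 : α < 1) {r : ℝ} (hr0 : 0 ≤ r)
    (hr1 : r < 1) :
    bohrSum N (extremal α) 0 r = majorant α r + P N (areaBound α r) := by
  have h0 : ∀ n, taylorCoeff 0 n = 0 := fun n => by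
    refine taylorCoeff_eq_of_hasSum (k := 0) (c := 0) (differentiableOn_const 0) (fun z _ => ?_) n
    simp
  have h1 : ∀ n, bohrTerm (extremal α) 0 r (n + 2) = 2 * (1 - α) / (n + 2) * r ^ (n + 2) :=
    fun n => by
      rw [bohrTerm, h0, taylorCoeff_extremal hα1, norm_real, norm_zero, add_zero,
        Real.norm_of_nonneg (div_nonneg (by linarith) (by positivity))]
  rw [bohrSum, area_extremal hα0 hα1 hr0 hr1, mul_div_cancel_left₀ _ Real.pi_ne_zero]
  simp only [h1]
  rw [(hasSum_majorant α hr0 hr1).tsum_eq]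
  ring

theorem extremal_neg_one (α : ℝ) : extremal α (-1) = (-growth α 1 : ℝ) := by
  have : log (1 - -1) = (Real.log 2 : ℝ) := by
    rw [ofReal_log (by norm_num)]; norm_num
  rw [extremal, this, growth, one_add_one_eq_two]
  push_cast
  ring

/-- The boundary value at `-1` is omitted: `Re h' > 0` inside the segment from `-1` to any point
of the disk. -/
theorem extremal_neg_one_notMem {α : ℝ} (hα0 : 0 ≤ α) (hα1 : α < 1) :
    extremal α (-1) ∉ imageDisk (extremal α) 0 1 := by
  rintro ⟨z, hz, e⟩
  have hz1 := re_lt_one_of_mem_ball hz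
  have hne : z + 1 ≠ 0 := fun h => by
    rw [eq_neg_of_add_eq_zero_left h] at hz
    simp at hz
  have hball : ∀ t ∈ Ioo (0 : ℝ) 1, -1 + t * (z + 1) ∈ ball (0 : ℂ) 1 := fun t ht => by
    rw [mem_ball_zero_iff] at hz ⊢
    calc ‖-1 + t * (z + 1)‖ = ‖((1 - t : ℝ) : ℂ) * (-1) + t * z‖ := by
          congr 1; push_cast; ring
      _ ≤ (1 - t) + t * ‖z‖ := by
          refine (norm_add_le _ _).trans (le_of_eq ?_)
          rw [norm_mul, norm_mul, norm_real, norm_real, Real.norm_of_nonneg (by linarith [ht.2]),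
            Real.norm_of_nonneg ht.1.le, norm_neg, norm_one, mul_one]
      _ < 1 := by nlinarith [ht.1]
  have hre : ∀ t ∈ Icc (0 : ℝ) 1, (-1 + t * (z + 1)).re < 1 := fun t ht => by
    have hz2 := (abs_le.1 ((abs_re_le_norm z).trans (mem_ball_zero_iff.1 hz).le)).1
    simp
    nlinarith [ht.1, ht.2]
  refine harmonicMap_ne_of_segment (h := extremal α) (g := 0) (w := -1) hne
    (fun t ht => ?_) (fun t ht => ?_) ?_
  · have h1 : ContinuousAt (harmonicMap (extremal α) 0) (-1 + t * (z + 1)) :=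
      (hasDerivAt_extremal α (hre t ht)).continuousAt.add
        (continuous_conj.continuousAt.comp continuousAt_const)
    exact (h1.comp (f := fun t : ℝ => (-1 + t * (z + 1) : ℂ)) (by fun_prop)).continuousWithinAt
  · refine ⟨(hasDerivAt_extremal α (hre t (Ioo_subset_Icc_self ht))).differentiableAt,
      differentiableAt_const 0, ?_⟩
    exact (memPH0_extremal hα1).norm_deriv_g_lt_re hα0 (hball t ht)
  · have e2 : harmonicMap (extremal α) 0 (-1) = extremal α (-1) := by simp [harmonicMap]
    rw [e2, ← e]
    congr 1; ring

/-- The disk of radius `growth α 1` about `0` contains the value `0` and the omitted value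
`extremal α (-1)`, so by connectedness it meets the boundary of the image. -/
theorem distBoundary_extremal_le {α : ℝ} (hα0 : 0 ≤ α) (hα1 : α < 1) :
    distBoundary (extremal α) 0 ≤ growth α 1 := by
  have m := memPH0_extremal hα1
  have hgr := growth_one_pos hα0
  have h0 : (0 : ℂ) ∈ imageDisk (extremal α) 0 1 := ⟨0, by simp, m.harmonicMap_zero⟩
  have hv : extremal α (-1) ∈ closedBall (0 : ℂ) (growth α 1) := by
    rw [mem_closedBall_zero_iff, extremal_neg_one, norm_real, norm_neg,
      Real.norm_of_nonneg hgr.le]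
  obtain ⟨w, hw, hwf⟩ : (closedBall (0 : ℂ) (growth α 1) ∩
      frontier (imageDisk (extremal α) 0 1)).Nonempty := by
    by_contra hempty
    have hopen := m.isOpen_imageDisk hα0 le_rfl
    have hcov : closedBall (0 : ℂ) (growth α 1) ⊆
        imageDisk (extremal α) 0 1 ∪ (closure (imageDisk (extremal α) 0 1))ᶜ := by
      intro w hw
      by_contra hw2
      rw [mem_union, not_or, mem_compl_iff, not_not] at hw2
      exact hempty ⟨w, hw, hopen.frontier_eq ▸ ⟨hw2.2, hw2.1⟩⟩
    obtain ⟨w, -, hw1, hw2⟩ := (convex_closedBall (0 : ℂ) (growth α 1)).isPreconnected _ _ hopen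
      isClosed_closure.isOpen_compl hcov ⟨0, mem_closedBall_self hgr.le, h0⟩
      ⟨_, hv, (hcov hv).resolve_left (extremal_neg_one_notMem hα0 hα1)⟩
    exact hw2 (subset_closure hw1)
  rw [distBoundary, m.harmonicMap_zero]
  refine (infDist_le_dist_of_mem hwf).trans ?_
  rw [dist_zero_left]
  exact mem_closedBall_zero_iff.1 hw

end HarmonicBohr

theorem mainTheorem2 (α : ℝ) (hα0 : 0 ≤ α) (hα1 : α < 1) (N : ℕ) (hN : 1 ≤ N) :
    ∃ ρ : ℝ,
      IsLeast {r : ℝ | r ∈ Set.Ioo (0 : ℝ) 1 ∧ HarmonicBohr.radiusFun N α r = 0} ρ ∧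
      (∀ h g : ℂ → ℂ, HarmonicBohr.MemPH0 α h g →
        (frontier (HarmonicBohr.imageDisk h g 1)).Nonempty ∧
        ∀ r : ℝ, 0 ≤ r → r ≤ ρ →
          Summable (fun n : ℕ => HarmonicBohr.bohrTerm h g r (n + 2)) ∧
          MeasureTheory.volume (HarmonicBohr.imageDisk h g r) ≠ ⊤ ∧
          HarmonicBohr.bohrSum N h g r ≤ HarmonicBohr.distBoundary h g) ∧
      (∀ r : ℝ, ρ < r → r < 1 →
        ∃ h g : ℂ → ℂ, HarmonicBohr.MemPH0 α h g ∧
          HarmonicBohr.distBoundary h g < HarmonicBohr.bohrSum N h g r) := by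
  obtain ⟨ρ, hρ, hρ0⟩ := HarmonicBohr.exists_radiusFun_eq_zero N hα0 hα1
  have hmono := HarmonicBohr.radiusFun_strictMonoOn N hα1
  have hρI : ρ ∈ Set.Ico (0 : ℝ) 1 := ⟨hρ.1.le, hρ.2⟩
  refine ⟨ρ, ⟨⟨hρ, hρ0⟩, fun s hs => ?_⟩, fun h g m => ⟨m.frontier_nonempty hα0,
    fun r hr0 hr => ?_⟩, fun r hr hr1 => ⟨_, _, HarmonicBohr.memPH0_extremal hα1, ?_⟩⟩
  · exact (hmono.le_iff_le hρI ⟨hs.1.1.le, hs.1.2⟩).1 (by rw [hρ0, hs.2])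
  · have hr1 := hr.trans_lt hρ.2
    refine ⟨m.summable_bohrTerm hr0 hr1,
      ((m.volume_imageDisk_le hα0 hr0 hr1).trans_lt ENNReal.ofReal_lt_top).ne, ?_⟩
    have h1 := hmono.monotoneOn ⟨hr0, hr1⟩ hρI hr
    rw [hρ0, HarmonicBohr.radiusFun_eq N α hr1] at h1
    linarith [m.bohrSum_le N hα0 hr0 hr1, m.growth_one_le_distBoundary hα0 hα1]
  · have hr0 := hρ.1.trans hr
    have h1 := hmono hρI ⟨hr0.le, hr1⟩ hr
    rw [hρ0, HarmonicBohr.radiusFun_eq N α hr1] at h1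
    rw [HarmonicBohr.bohrSum_extremal N hα0 hα1 hr0.le hr1]
    linarith [HarmonicBohr.distBoundary_extremal_le hα0 hα1]
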